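/- \textbf{Theorem (embedding theorem).} Notation. A Euclidean space $E$ of dimension $n$ is fixed, with $\langle u,\varphi\rangle$ the bilinear pairing of distributions and test functions. For $u\in\mathcal D'(E)$, $\chi\in C_0^\infty(E)$ and $y,\xi\in E$ put $$\widehat{u\tau_y\chi}(\xi)=\left\langle u,\,e^{-i\langle\cdot,\xi\rangle}\chi(\cdot-y)\right\rangle ,$$ and for $1\le p\le\infty$ let $$U_{\chi,p}(\xi)=\Big(\int_E|\widehat{u\tau_y\chi}(\xi)|^p\,dy\Big)^{1/p}\ (p<\infty),\qquad U_{\chi,\infty}(\xi)=\sup_{y\in E}|\widehat{u\tau_y\chi}(\xi)| .$$ $S_w^p(E)$ is the set of $u\in\mathcal D'(E)$ such that for some $\chi\in C_0^\infty(E)\setminus\{0\}$ the function $U_{\chi,p}$ is finite everywhere and belongs to $L^1(E)$; its topology is the one given by any of the equivalent norms $\|u\|_{S_w^p,\chi}=\int_E U_{\chi,p}(\xi)\,d\xi$, $\chi\in C_0^\infty(E)\setminus\{0\}$. Let $E=V_1\oplus\dots\oplus V_k$ be an orthogonal decomposition, let $\xi_j$ be the component of $\xi\in E$ in $V_j$,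 and let $\mathbf t=(t_1,\dots,t_k)\in\mathbb R^k$. Let $\langle\langle D\rangle\rangle^{\mathbf t}=(1-\Delta_{V_1})^{t_1/2}\otimes\dots\otimes(1-\Delta_{V_k})^{t_k/2}$ be the operator on $\mathcal S'(E)$ which multiplies the Fourier transform (taken with the kernel $e^{-i\langle x,\xi\rangle}$) by $\prod_{j=1}^k(1+|\xi_j|^2)^{t_j/2}$, and put $$\mathcal H^{\mathbf t}_{p,V_1,\dots,V_k}(E)=\{u\in\mathcal S'(E):\ \langle\langle D\rangle\rangle^{\mathbf t}u\in L^p(E)\},\qquad \|u\|_{\mathcal H^{\mathbf t}_{p}}=\|\langle\langle D\rangle\rangle^{\mathbf t}u\|_{L^p}.$$ Statement. Let $1\le p\le\infty$. (a) Let $\mathbb R^n=\mathbb R^{n_1}\times\dots\times\mathbb R^{n_k}$ and $t_1>n_1,\dots,t_k>n_k$. Then $\mathcal H^{\mathbf t}_p(\mathbb R^n)=\mathcal H^{\mathbf t}_{p,\mathbb R^{n_1},\dots,\mathbb R^{n_k}}(\mathbb R^n)$ embeds continuously into $S_w^p(\mathbb R^n)$. (b) More generally, let $\mathbb R^n=V_1\oplus\dots\oplus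 V_k$ be an orthogonal decomposition and $t_1>\dim V_1,\dots,t_k>\dim V_k$. Then $\mathcal H^{\mathbf t}_{p,V_1,\dots,V_k}(\mathbb R^n)$ embeds continuously into $S_w^p(\mathbb R^n)$. Here "embeds continuously" means: the canonical map $\mathcal S'\to\mathcal D'$ sends the first space injectively into the second, and for every $\chi\in C_0^\infty(\mathbb R^n)\setminus\{0\}$ there is a constant $C$ such that $\|u\|_{S_w^p,\chi}\le C\|u\|_{\mathcal H^{\mathbf t}_p}$ for all $u$ in the first space. -/

import Mathlib

open MeasureTheory TemperedDistribution TopologicalSpace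
open scoped SchwartzMap Distributions ENNReal NNReal

noncomputable section

namespace Sjostrand

section Distributions

variable {E : Type*} [NormedAddCommGroup E] [InnerProductSpace ℝ E]

variable (E) in
/-- The test functions on all of `E`: complex-valued smooth functions with compact support,
with the canonical LF topology. -/
abbrev TestFn : Type _ := 𝓓((⊤ : Opens E), ℂ)

variable (E) in
/-- The (complex) distributions on `E`: continuous `ℂ`-linear forms on the test functions. -/
abbrev Distr : Type _ := TestFn E →L[ℂ] ℂ

/-- A test function, viewed as a Schwartz function. -/
def toSchwartz (φ : TestFn E) : 𝓢(E, ℂ) :=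
  φ.hasCompactSupport.toSchwartzMap φ.contDiff

@[simp]
theorem toSchwartz_apply (φ : TestFn E) (x : E) : toSchwartz φ x = φ x := rfl

theorem continuous_toSchwartz_comp (K : Compacts E)
    (hK : (K : Set E) ⊆ ((⊤ : Opens E) : Set E)) :
    Continuous (toSchwartz ∘ (TestFunction.ofSupportedIn hK : 𝓓_{K}(E, ℂ) → TestFn E)) := by
  let L : 𝓓_{K}(E, ℂ) →ₗ[ℝ] 𝓢(E, ℂ) :=
    { toFun := fun f => toSchwartz (TestFunction.ofSupportedIn hK f)
      map_add' := fun f g => by ext x; rfl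
      map_smul' := fun c f => by ext x; rfl }
  change Continuous L
  refine WithSeminorms.continuous_of_isBounded
    (ContDiffMapSupportedIn.withSeminorms ℝ E ℂ ⊤ K)
    (schwartz_withSeminorms ℝ E ℂ) L ?_
  rintro ⟨k, m⟩
  obtain ⟨R, hR⟩ := K.isCompact.isBounded.exists_norm_le
  refine ⟨{m}, (max R 0 ^ k).toNNReal, fun f => ?_⟩
  have hR0 : 0 ≤ max R 0 ^ k := pow_nonneg (le_max_right _ _) _
  refine SchwartzMap.seminorm_le_bound ℝ k m _ (by positivity) fun x => ?_
  have hle : ‖iteratedFDeriv ℝ m f x‖ ≤ ContDiffMapSupportedIn.seminorm ℝ E ℂ ⊤ K m f :=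
    ContDiffMapSupportedIn.norm_iteratedFDeriv_apply_le_seminorm_top ℝ
  change ‖x‖ ^ k * ‖iteratedFDeriv ℝ m f x‖ ≤ _
  simp only [Finset.sup_singleton, _root_.smul_apply]
  rw [NNReal.smul_def, Real.coe_toNNReal _ hR0, smul_eq_mul]
  by_cases hx : x ∈ K
  · have : ‖x‖ ^ k ≤ max R 0 ^ k :=
      pow_le_pow_left₀ (norm_nonneg _) ((hR x hx).trans (le_max_left _ _)) _
    gcongr
  · have h0 : iteratedFDeriv ℝ m f x = 0 := f.iteratedFDeriv_zero_on_compl hx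
    rw [h0, norm_zero, mul_zero]
    positivity

/-- The continuous inclusion of the test functions into the Schwartz space. -/
def toSchwartzCLM : TestFn E →L[ℂ] 𝓢(E, ℂ) :=
  TestFunction.mkCLM ℂ toSchwartz (fun _ _ => by ext; rfl) (fun _ _ => by ext; rfl)
    continuous_toSchwartz_comp

/-- The canonical map from tempered distributions to distributions: restriction to the test
functions. -/
def restrict (u : 𝓢'(E, ℂ)) : Distr E where
  toFun φ := u (toSchwartzCLM φ)
  map_add' φ ψ := by simp
  map_smul' c φ := by simp
  cont := u.continuous.comp toSchwartzCLM.continuous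

/-- The test function `x ↦ exp (-i ⟨x, ξ⟩) χ (x - y)`. -/
def modTrans (χ : TestFn E) (y ξ : E) : TestFn E where
  toFun x := Complex.exp (-Complex.I * (inner ℝ x ξ : ℝ)) * χ (x - y)
  contDiff' := by
    have h1 : ContDiff ℝ ((⊤ : ℕ∞) : WithTop ℕ∞) (fun x : E => ((inner ℝ x ξ : ℝ) : ℂ)) :=
      Complex.ofRealCLM.contDiff.comp (contDiff_id.inner ℝ contDiff_const)
    have h2 : ContDiff ℝ ((⊤ : ℕ∞) : WithTop ℕ∞) (fun x : E => χ (x - y)) :=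
      χ.contDiff.comp (contDiff_id.sub contDiff_const)
    exact ((contDiff_const.mul h1).cexp).mul h2
  hasCompactSupport' := by
    have : HasCompactSupport (fun x : E => χ (x - y)) :=
      χ.hasCompactSupport.comp_homeomorph (Homeomorph.subRight y)
    exact this.mul_left
  tsupport_subset' := fun _ _ => trivial

/-- The Fourier transform of `u τ_y χ` at `ξ`, that is
`⟨u, exp (-i ⟨·, ξ⟩) χ (· - y)⟩`. -/
def localFourier (u : Distr E) (χ : TestFn E) (y ξ : E) : ℂ :=
  u (modTrans χ y ξ)

variable [FiniteDimensional ℝ E] [MeasurableSpace E] [BorelSpace E]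

/-- The function `U_{χ,p}` of `ξ`: the supremum over `y` (for `p = ∞`) or the `L^p` norm in `y`
(for `p < ∞`) of the Fourier transform of `u τ_y χ` at `ξ`. -/
def U (u : Distr E) (χ : TestFn E) (p : ℝ≥0∞) (ξ : E) : ℝ≥0∞ :=
  if p = ∞ then ⨆ y : E, ‖localFourier u χ y ξ‖ₑ
  else (∫⁻ y : E, ‖localFourier u χ y ξ‖ₑ ^ p.toReal) ^ (1 / p.toReal)

/-- The set `S_w^p(E)` of the distributions `u` for which there is a test function `χ ≠ 0` such
that `U_{χ,p}` is finite everywhere, measurable and integrable. -/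
def Sw (E : Type*) [NormedAddCommGroup E] [InnerProductSpace ℝ E] [FiniteDimensional ℝ E]
    [MeasurableSpace E] [BorelSpace E] (p : ℝ≥0∞) : Set (Distr E) :=
  {u | ∃ χ : TestFn E, χ ≠ 0 ∧ (∀ ξ, U u χ p ξ < ∞) ∧
    AEMeasurable (U u χ p) ∧ ∫⁻ ξ, U u χ p ξ < ∞}

/-- `‖u‖_{S_w^p, χ} = ∫ U_{χ,p}(ξ) dξ`. -/
def swNorm (p : ℝ≥0∞) (χ : TestFn E) (u : Distr E) : ℝ≥0∞ :=
  ∫⁻ ξ, U u χ p ξ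

end Distributions

section Bessel

variable {E : Type*} [NormedAddCommGroup E] [InnerProductSpace ℝ E] [FiniteDimensional ℝ E]
  [MeasurableSpace E] [BorelSpace E]
  {ι : Type*} [Fintype ι] {G : ι → Type*} [∀ j, NormedAddCommGroup (G j)]
  [∀ j, InnerProductSpace ℝ (G j)]

/-- The weight `⟨⟨ξ⟩⟩^t = ∏_j (1 + |P_j ξ|²)^{t_j/2}`, where `P_j ξ` are the components of `ξ`. -/
def weight (P : ∀ j, E →L[ℝ] G j) (t : ι → ℝ) (ξ : E) : ℝ :=
  ∏ j, (1 + ‖P j ξ‖ ^ 2) ^ (t j / 2)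

/-- The operator `⟨⟨D⟩⟩^t = (1 - Δ_1)^{t_1/2} ⊗ ... ⊗ (1 - Δ_k)^{t_k/2}` on tempered
distributions. The factor `2π` comes from the convention `∫ exp (-2πi⟨x, ξ⟩) f(x) dx` for the
Fourier transform in Mathlib, for which `D = -i∂` is multiplication by `2πξ`. -/
def bessel (P : ∀ j, E →L[ℝ] G j) (t : ι → ℝ) : 𝓢'(E, ℂ) →L[ℂ] 𝓢'(E, ℂ) :=
  fourierMultiplierCLM ℂ (fun ξ => (weight P t ((2 * Real.pi) • ξ) : ℂ))

/-- The multiplier of `bessel` has temperate growth, so that `bessel` is the genuine Fourier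
multiplier. -/
theorem hasTemperateGrowth_weight (P : ∀ j, E →L[ℝ] G j) (t : ι → ℝ) :
    (fun ξ : E => (weight P t ((2 * Real.pi) • ξ) : ℂ)).HasTemperateGrowth := by
  have key : ∀ s : Finset ι, (fun ξ : E =>
      ((∏ j ∈ s, (1 + ‖P j ((2 * Real.pi) • ξ)‖ ^ 2) ^ (t j / 2) : ℝ) : ℂ)).HasTemperateGrowth := by
    classical
    intro s
    induction s using Finset.induction_on with
    | empty => simp
    | insert a s ha ih =>
      have h1 := (Function.hasTemperateGrowth_one_add_norm_sq_rpow (G a) (t a / 2)).comp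
        (g := fun x : G a => (1 + ‖x‖ ^ 2) ^ (t a / 2))
        (((2 * Real.pi) • P a).hasTemperateGrowth)
      have h2 := (Complex.ofRealCLM.hasTemperateGrowth).comp h1
      refine Eq.mp (congrArg _ (funext fun ξ => ?_)) (h2.mul ih)
      simp [Finset.prod_insert ha]
  exact key Finset.univ

/-- The anisotropic Bessel potential space of the tempered distributions `u` for which
`⟨⟨D⟩⟩^t u` belongs to `L^p`. -/
def besselSpace (P : ∀ j, E →L[ℝ] G j) (t : ι → ℝ) (p : ℝ≥0∞) [Fact (1 ≤ p)] :
    Submodule ℂ 𝓢'(E, ℂ) :=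
  (Lp.toTemperedDistributionCLM ℂ (volume : Measure E) p).range.comap
    (bessel P t : 𝓢'(E, ℂ) →ₗ[ℂ] 𝓢'(E, ℂ))

theorem mem_besselSpace {P : ∀ j, E →L[ℝ] G j} {t : ι → ℝ} {p : ℝ≥0∞} [Fact (1 ≤ p)]
    {u : 𝓢'(E, ℂ)} : u ∈ besselSpace P t p ↔
      ∃ f : Lp ℂ p (volume : Measure E), Lp.toTemperedDistribution f = bessel P t u :=
  Iff.rfl

/-- `‖u‖ = ‖⟨⟨D⟩⟩^t u‖_{L^p}`. -/
def besselNorm {P : ∀ j, E →L[ℝ] G j} {t : ι → ℝ} {p : ℝ≥0∞} [Fact (1 ≤ p)]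
    (u : besselSpace P t p) : ℝ :=
  ‖(mem_besselSpace.1 u.2).choose‖

theorem besselNorm_eq {P : ∀ j, E →L[ℝ] G j} {t : ι → ℝ} {p : ℝ≥0∞} [Fact (1 ≤ p)]
    (u : besselSpace P t p) (f : Lp ℂ p (volume : Measure E))
    (hf : Lp.toTemperedDistribution f = bessel P t (u : 𝓢'(E, ℂ))) : besselNorm u = ‖f‖ := by
  have h := (mem_besselSpace.1 u.2).choose_spec
  have hinj : Function.Injective (Lp.toTemperedDistributionCLM ℂ (volume : Measure E) p) :=
    LinearMap.ker_eq_bot.1 Lp.ker_toTemperedDistributionCLM_eq_bot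
  unfold besselNorm
  rw [hinj (h.trans hf.symm)]

/-- The continuous embedding of the anisotropic Bessel potential space into `S_w^p`: the canonical
map from tempered distributions to distributions maps the first space injectively into the second,
and is bounded for each of the (equivalent) norms of `S_w^p`. -/
def EmbedsInSw (P : ∀ j, E →L[ℝ] G j) (t : ι → ℝ) (p : ℝ≥0∞) [Fact (1 ≤ p)] : Prop :=
  (∀ u : besselSpace P t p, restrict (u : 𝓢'(E, ℂ)) ∈ Sw E p) ∧
  (∀ u v : besselSpace P t p,
    restrict (u : 𝓢'(E, ℂ)) = restrict (v : 𝓢'(E, ℂ)) → u = v) ∧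
  (∀ χ : TestFn E, χ ≠ 0 → ∃ C : ℝ≥0, ∀ u : besselSpace P t p,
    swNorm p χ (restrict (u : 𝓢'(E, ℂ))) ≤ C * ENNReal.ofReal (besselNorm u))

end Bessel

end Sjostrand

end

/-!
Let `f = ⟨⟨D⟩⟩^t u ∈ L^p`, and let `w` be the weight, so that `u = w(D)⁻¹ f`. Multipliers commute with
translations and are shifted by modulations, so that moving `w(D)⁻¹` to the test function gives
`⟨u, exp (-i⟨·, ξ⟩) χ(· - y)⟩ = ∫ f(x) exp (-i⟨x, ξ⟩) K_ξ(x - y) dx`, where `K_ξ` has the Fourier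
transform `χ̂ / w(· - ξ)` (`multiplier_modTrans`, `localFourier_eq_integral`). Young's inequality then
bounds `U_{χ,p}(ξ)` by `‖f‖_p ‖K_ξ‖_1` (`U_le`).

The derivatives of `w⁻¹` are bounded by multiples of `w⁻¹` itself (`derivDominated_weight`), and
`1 / w(ζ + ξ) ≤ C w(ζ) / w(ξ)` by Peetre's inequality (`weight_neg_add_le`). Hence every Schwartz
seminorm of `χ̂ / w(· - ξ)`, and with it `‖K_ξ‖_1`, is at most `C / w(ξ)`
(`exists_seminorm_shiftedProduct_le`, `exists_eLpNorm_kernel_le`). The function `1 / w` is a product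
of the factors `(1 + |ξ_j|²)^{-t_j/2}`, integrable since `t_j > dim V_j` (`integrable_weight_neg`).
Integrating in `ξ` gives the bound of the norms.

The injectivity of the restriction from tempered distributions to distributions is the density of
the test functions in the Schwartz space (`tendsto_toSchwartz_cutoffMul`).
-/

namespace Sjostrand

/-! ### Functions that dominate their derivatives -/

section DerivDominated

variable {H F : Type*} [NormedAddCommGroup H] [NormedSpace ℝ H] [NormedAddCommGroup F]
  [NormedSpace ℝ F]

/-- A smooth function `h` all of whose derivatives are bounded by constant multiples of `h`. -/
def DerivDominated (h : H → ℝ) : Prop :=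
  ContDiff ℝ ((⊤ : ℕ∞) : WithTop ℕ∞) h ∧
    ∀ n : ℕ, ∃ C : ℝ, 0 ≤ C ∧ ∀ x, ‖iteratedFDeriv ℝ n h x‖ ≤ C * h x

theorem DerivDominated.nonneg {h : H → ℝ} (hh : DerivDominated h) (x : H) : 0 ≤ h x := by
  obtain ⟨C, hC0, hC⟩ := hh.2 0
  have h0 := (norm_nonneg _).trans (hC x)
  have h1 := hC x
  rw [norm_iteratedFDeriv_zero, Real.norm_eq_abs] at h1
  by_contra! hx
  have := mul_nonneg_iff.1 h0
  rcases this with h | h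
  · exact absurd h.2 (not_le.2 hx)
  · have hC' : C = 0 := le_antisymm h.1 hC0
    rw [hC', zero_mul] at h1
    exact hx.ne (abs_eq_zero.1 (le_antisymm h1 (abs_nonneg _)))

theorem derivDominated_one : DerivDominated (fun _ : H => (1 : ℝ)) := by
  refine ⟨contDiff_const, fun n => ⟨1, zero_le_one, fun x => ?_⟩⟩
  rcases n with _ | n
  · simp
  · rw [iteratedFDeriv_const_of_ne (Nat.succ_ne_zero n)]
    simp

theorem DerivDominated.mul {f g : H → ℝ} (hf : DerivDominated f) (hg : DerivDominated g) :
    DerivDominated (fun x => f x * g x) := by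
  refine ⟨hf.1.mul hg.1, fun n => ?_⟩
  choose A hA0 hA using hf.2
  choose B hB0 hB using hg.2
  refine ⟨∑ i ∈ Finset.range (n + 1), (n.choose i : ℝ) * A i * B (n - i),
    Finset.sum_nonneg fun i _ => mul_nonneg (mul_nonneg (by positivity) (hA0 _)) (hB0 _),
    fun x => ?_⟩
  refine (norm_iteratedFDeriv_mul_le hf.1 hg.1 x (n := n) (by exact_mod_cast le_top)).trans ?_
  rw [Finset.sum_mul]
  refine Finset.sum_le_sum fun i _ => ?_
  calc (n.choose i : ℝ) * ‖iteratedFDeriv ℝ i f x‖ * ‖iteratedFDeriv ℝ (n - i) g x‖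
      ≤ (n.choose i : ℝ) * (A i * f x) * (B (n - i) * g x) := by
        have := mul_nonneg (hA0 i) (hf.nonneg x)
        gcongr
        · exact hA i x
        · exact hB (n - i) x
    _ = _ := by ring

theorem DerivDominated.prod {ι : Type*} (s : Finset ι) {f : ι → H → ℝ}
    (hf : ∀ i ∈ s, DerivDominated (f i)) : DerivDominated (fun x => ∏ i ∈ s, f i x) := by
  classical
  induction s using Finset.induction_on with
  | empty => simpa using derivDominated_one
  | insert a s ha ih =>
    simp only [Finset.prod_insert ha]
    exact (hf a (by simp)).mul (ih fun i hi => hf i (by simp [hi]))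

theorem DerivDominated.comp_clm {h : H → ℝ} (hh : DerivDominated h) (L : F →L[ℝ] H) :
    DerivDominated (fun x => h (L x)) := by
  refine ⟨hh.1.comp L.contDiff, fun n => ?_⟩
  obtain ⟨C, hC0, hC⟩ := hh.2 n
  refine ⟨C * ‖L‖ ^ n, by positivity, fun x => ?_⟩
  have h1 := L.iteratedFDeriv_comp_right hh.1 x (i := n) (by exact_mod_cast le_top)
  change ‖iteratedFDeriv ℝ n (h ∘ L) x‖ ≤ _
  rw [h1]
  refine (ContinuousMultilinearMap.norm_compContinuousLinearMap_le _ _).trans ?_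
  rw [Finset.prod_const, Finset.card_univ, Fintype.card_fin]
  calc _ ≤ C * h (L x) * ‖L‖ ^ n := by
        gcongr
        exact hC _
    _ = _ := by ring

theorem DerivDominated.comp_add_const {h : H → ℝ} (hh : DerivDominated h) (n : ℕ) :
    ∃ C : ℝ, 0 ≤ C ∧ ∀ a x, ‖iteratedFDeriv ℝ n (fun z => h (z + a)) x‖ ≤ C * h (x + a) := by
  obtain ⟨C, hC0, hC⟩ := hh.2 n
  exact ⟨C, hC0, fun a x => by rw [iteratedFDeriv_comp_add_right]; exact hC _⟩

end DerivDominated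

section JapaneseBracket

variable {H : Type*} [NormedAddCommGroup H] [InnerProductSpace ℝ H]

theorem fderiv_one_add_norm_sq_rpow (s : ℝ) (x : H) :
    fderiv ℝ (fun x : H => (1 + ‖x‖ ^ 2) ^ s) x =
      (1 + ‖x‖ ^ 2) ^ (s - 1) • ((2 * s) • innerSL ℝ x) := by
  have h1 : HasFDerivAt (fun x : H => 1 + ‖x‖ ^ 2) (2 • innerSL ℝ x) x :=
    (hasStrictFDerivAt_norm_sq x).hasFDerivAt.const_add 1
  have h2 := h1.rpow_const (p := s) (Or.inl (by positivity))
  rw [h2.fderiv]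
  ext v
  simp
  ring

theorem contDiff_one_add_norm_sq_rpow (s : ℝ) :
    ContDiff ℝ ((⊤ : ℕ∞) : WithTop ℕ∞) (fun x : H => (1 + ‖x‖ ^ 2) ^ s) :=
  (contDiff_const.add (contDiff_norm_sq ℝ)).rpow_const_of_ne fun x => by positivity

/-- The powers of `1 + ‖x‖²` dominate their derivatives: differentiating lowers the exponent by
one and produces a linear factor, which is bounded by `1 + ‖x‖²`. -/
theorem derivDominated_one_add_norm_sq_rpow (s : ℝ) :
    DerivDominated (fun x : H => (1 + ‖x‖ ^ 2) ^ s) := by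
  refine ⟨contDiff_one_add_norm_sq_rpow s, fun n => ?_⟩
  induction n using Nat.strong_induction_on generalizing s with
  | _ n ih =>
  rcases n with _ | n
  · refine ⟨1, zero_le_one, fun x => ?_⟩
    rw [norm_iteratedFDeriv_zero, Real.norm_of_nonneg (by positivity), one_mul]
  have hA : ∀ i : ℕ, ∃ A : ℝ, 0 ≤ A ∧ (i ≤ n → ∀ x : H,
      ‖iteratedFDeriv ℝ i (fun x : H => (1 + ‖x‖ ^ 2) ^ (s - 1)) x‖ ≤
        A * (1 + ‖x‖ ^ 2) ^ (s - 1)) := by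
    intro i
    by_cases hi : i ≤ n
    · obtain ⟨A, hA0, hA⟩ := ih i (by omega) (s - 1)
      exact ⟨A, hA0, fun _ => hA⟩
    · exact ⟨0, le_rfl, fun h => absurd h hi⟩
  choose A hA0 hA using hA
  let L : H →L[ℝ] (H →L[ℝ] ℝ) := (2 * s) • innerSL ℝ
  have hL : ∀ j : ℕ, ∃ B : ℝ, 0 ≤ B ∧ ∀ x : H,
      ‖iteratedFDeriv ℝ j L x‖ ≤ B * (1 + ‖x‖ ^ 2) := by
    intro j
    rcases j with _ | _ | j
    · refine ⟨‖L‖, L.opNorm_nonneg, fun x => ?_⟩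
      rw [norm_iteratedFDeriv_zero]
      refine (L.le_opNorm x).trans ?_
      gcongr
      nlinarith [sq_nonneg (‖x‖ - 1)]
    · refine ⟨‖L‖, L.opNorm_nonneg, fun x => ?_⟩
      rw [zero_add, norm_iteratedFDeriv_one, L.fderiv]
      exact le_mul_of_one_le_right L.opNorm_nonneg (by nlinarith [sq_nonneg ‖x‖])
    · refine ⟨0, le_rfl, fun x => ?_⟩
      have h0 : iteratedFDeriv ℝ (j + 2) L x = 0 := by
        have h1 : fderiv ℝ (fun x => L x) = fun _ => L := by
          ext1 x; exact L.fderiv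
        have h2 := norm_iteratedFDeriv_fderiv (𝕜 := ℝ) (f := fun x => L x) (x := x) (n := j + 1)
        rw [h1, iteratedFDeriv_const_of_ne (Nat.succ_ne_zero j)] at h2
        exact norm_eq_zero.1 (by rw [← h2]; simp)
      rw [h0]; simp
  choose B hB0 hB using hL
  refine ⟨∑ i ∈ Finset.range (n + 1), (n.choose i : ℝ) * A i * B (n - i),
    Finset.sum_nonneg fun i _ => mul_nonneg (mul_nonneg (by positivity) (hA0 _)) (hB0 _),
    fun x => ?_⟩
  rw [← norm_iteratedFDeriv_fderiv]
  have hfd : fderiv ℝ (fun x : H => (1 + ‖x‖ ^ 2) ^ s) =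
      fun x => (1 + ‖x‖ ^ 2) ^ (s - 1) • L x := by
    ext1 x; exact fderiv_one_add_norm_sq_rpow s x
  rw [hfd]
  refine (norm_iteratedFDeriv_smul_le (contDiff_one_add_norm_sq_rpow (s - 1)) L.contDiff x
    (n := n) (by exact_mod_cast le_top)).trans ?_
  rw [Finset.sum_mul]
  refine Finset.sum_le_sum fun i hi => ?_
  have hi : i ≤ n := by simpa [Nat.lt_succ_iff] using hi
  have hsplit : (1 + ‖x‖ ^ 2) ^ s = (1 + ‖x‖ ^ 2) ^ (s - 1) * (1 + ‖x‖ ^ 2) := by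
    rw [← Real.rpow_add_one (by positivity), sub_add_cancel]
  calc _ ≤ (n.choose i : ℝ) * (A i * (1 + ‖x‖ ^ 2) ^ (s - 1)) * (B (n - i) * (1 + ‖x‖ ^ 2)) := by
        have := hA0 i
        gcongr
        · exact hA i hi x
        · exact hB (n - i) x
    _ = _ := by simp only [hsplit]; ring

end JapaneseBracket

/-! ### The weight -/

section Weight

variable {E : Type*} [NormedAddCommGroup E] [InnerProductSpace ℝ E]
  {ι : Type*} [Fintype ι] {G : ι → Type*} [∀ j, NormedAddCommGroup (G j)]
  [∀ j, InnerProductSpace ℝ (G j)]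

theorem weight_pos (P : ∀ j, E →L[ℝ] G j) (t : ι → ℝ) (ξ : E) : 0 < weight P t ξ :=
  Finset.prod_pos fun j _ => by positivity

theorem weight_mul_weight_neg (P : ∀ j, E →L[ℝ] G j) (t : ι → ℝ) (ξ : E) :
    weight P t ξ * weight P (-t) ξ = 1 := by
  unfold weight
  rw [← Finset.prod_mul_distrib]
  refine Finset.prod_eq_one fun j _ => ?_
  rw [← Real.rpow_add (by positivity), Pi.neg_apply]
  ring_nf
  exact Real.rpow_zero _

theorem derivDominated_weight (P : ∀ j, E →L[ℝ] G j) (t : ι → ℝ) :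
    DerivDominated (weight P t) :=
  DerivDominated.prod _ fun j _ =>
    (derivDominated_one_add_norm_sq_rpow (t j / 2)).comp_clm (P j)

theorem one_add_norm_sq_le_mul {H : Type*} [SeminormedAddCommGroup H] (a b : H) :
    1 + ‖b‖ ^ 2 ≤ 2 * (1 + ‖a‖ ^ 2) * (1 + ‖a + b‖ ^ 2) := by
  have h : ‖b‖ ≤ ‖a‖ + ‖a + b‖ := by
    have := norm_sub_le (a + b) a
    rw [add_sub_cancel_left] at this
    linarith
  have h2 : ‖b‖ ^ 2 ≤ (‖a‖ + ‖a + b‖) ^ 2 := by gcongr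
  nlinarith [sq_nonneg (‖a‖ - ‖a + b‖), mul_nonneg (sq_nonneg ‖a‖) (sq_nonneg ‖a + b‖)]

/-- Peetre's inequality for the weight. -/
theorem weight_neg_add_le (P : ∀ j, E →L[ℝ] G j) {t : ι → ℝ} (ht : ∀ j, 0 ≤ t j) (a b : E) :
    weight P (-t) (a + b) ≤ (∏ j, (2 : ℝ) ^ (t j / 2)) * weight P t a * weight P (-t) b := by
  unfold weight
  rw [← Finset.prod_mul_distrib, ← Finset.prod_mul_distrib]
  refine Finset.prod_le_prod (fun j _ => by positivity) fun j _ => ?_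
  have hj : 0 ≤ t j / 2 := by have := ht j; positivity
  have h := Real.rpow_le_rpow (by positivity) (one_add_norm_sq_le_mul (P j a) (P j b)) hj
  rw [Real.mul_rpow (by positivity) (by positivity), Real.mul_rpow (by positivity) (by positivity),
    ← map_add] at h
  rw [Pi.neg_apply, neg_div, Real.rpow_neg (by positivity), Real.rpow_neg (by positivity),
    ← div_eq_mul_inv, le_div_iff₀ (by positivity), inv_mul_le_iff₀ (by positivity)]
  linarith

end Weight


/-! ### The kernels of the localized Bessel potentials -/

section Kernel

open FourierTransform

variable {E : Type*} [NormedAddCommGroup E] [InnerProductSpace ℝ E]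
  {ι : Type*} [Fintype ι] {G : ι → Type*} [∀ j, NormedAddCommGroup (G j)]
  [∀ j, InnerProductSpace ℝ (G j)]

theorem continuous_weight (P : ∀ j, E →L[ℝ] G j) (t : ι → ℝ) : Continuous (weight P t) :=
  (derivDominated_weight P t).1.continuous

theorem two_pi_smul_add (ζ ξ : E) :
    (2 * Real.pi) • (ζ + (2 * Real.pi)⁻¹ • ξ) = (2 * Real.pi) • ζ + ξ := by
  rw [smul_add, smul_inv_smul₀ (by positivity)]

variable [FiniteDimensional ℝ E] [MeasurableSpace E] [BorelSpace E]

theorem hasTemperateGrowth_weight_shift (P : ∀ j, E →L[ℝ] G j) (t : ι → ℝ) (ξ : E) :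
    (fun ζ : E => (weight P t ((2 * Real.pi) • ζ + ξ) : ℂ)).HasTemperateGrowth := by
  have h := (hasTemperateGrowth_weight P t).comp
    (Function.HasTemperateGrowth.id'.add
      (Function.HasTemperateGrowth.const ((2 * Real.pi)⁻¹ • ξ)))
  refine Eq.mp (congrArg _ (funext fun ζ => ?_)) h
  simp only [Function.comp_apply, Pi.add_apply, two_pi_smul_add]

/-- The product of the Schwartz function `h` and the weight, taken at `2πζ + ξ`. -/
noncomputable def shiftedProduct (P : ∀ j, E →L[ℝ] G j) (t : ι → ℝ) (h : 𝓢(E, ℂ)) (ξ : E) :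
    𝓢(E, ℂ) :=
  SchwartzMap.smulLeftCLM ℂ (fun ζ : E => (weight P t ((2 * Real.pi) • ζ + ξ) : ℂ)) h

theorem shiftedProduct_apply (P : ∀ j, E →L[ℝ] G j) (t : ι → ℝ) (h : 𝓢(E, ℂ)) (ξ ζ : E) :
    shiftedProduct P t h ξ ζ = weight P t ((2 * Real.pi) • ζ + ξ) • h ζ := by
  rw [shiftedProduct, SchwartzMap.smulLeftCLM_apply_apply (hasTemperateGrowth_weight_shift P t ξ)]
  simp

/-- The Schwartz seminorms of a fixed function times the weight of negative exponent, translated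
by `ξ`, decay like that weight at `ξ`. -/
theorem exists_seminorm_shiftedProduct_le (P : ∀ j, E →L[ℝ] G j) {t : ι → ℝ} (ht : ∀ j, 0 ≤ t j)
    (h : 𝓢(E, ℂ)) (k n : ℕ) :
    ∃ C : ℝ, 0 ≤ C ∧ ∀ ξ : E,
      SchwartzMap.seminorm ℂ k n (shiftedProduct P (-t) h ξ) ≤ C * weight P (-t) ξ := by
  have hw := derivDominated_weight P (-t)
  have hw2 : DerivDominated fun ζ => weight P (-t) ((2 * Real.pi) • ζ) :=
    hw.comp_clm ((2 * Real.pi) • ContinuousLinearMap.id ℝ E)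
  choose A hA0 hA using fun i => hw2.comp_add_const i
  obtain ⟨N, B, hB0, hB⟩ := (hasTemperateGrowth_weight P t).norm_iteratedFDeriv_le_uniform 0
  have hB' : ∀ ζ : E, weight P t ((2 * Real.pi) • ζ) ≤ B * (1 + ‖ζ‖) ^ N := by
    intro ζ
    have := hB 0 le_rfl ζ
    rwa [norm_iteratedFDeriv_zero, Complex.norm_real,
      Real.norm_of_nonneg (weight_pos P t _).le] at this
  set c : ℝ := ∏ j, (2 : ℝ) ^ (t j / 2) with hc
  have hc0 : 0 ≤ c := Finset.prod_nonneg fun j _ => by positivity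
  set S : ℝ := 2 ^ (k + N) *
    (Finset.Iic (k + N, n)).sup (fun m => SchwartzMap.seminorm ℂ m.1 m.2) h with hS
  have hS0 : 0 ≤ S := by positivity
  refine ⟨∑ i ∈ Finset.range (n + 1), (n.choose i : ℝ) * A i * c * B * S,
    Finset.sum_nonneg fun i _ => ?_, fun ξ => ?_⟩
  · have := hA0 i
    positivity
  have hwξ := (weight_pos P (-t) ξ).le
  refine SchwartzMap.seminorm_le_bound ℂ k n _
    (mul_nonneg (Finset.sum_nonneg fun i _ => ?_) hwξ) fun ζ => ?_
  · have := hA0 i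
    positivity
  have hfun : (shiftedProduct P (-t) h ξ : E → ℂ) =
      fun ζ => weight P (-t) ((2 * Real.pi) • (ζ + (2 * Real.pi)⁻¹ • ξ)) • h ζ := by
    ext1 ζ
    rw [shiftedProduct_apply, two_pi_smul_add]
  rw [hfun]
  have hle := norm_iteratedFDeriv_smul_le (𝕜 := ℝ)
    (hw2.1.comp (contDiff_id.add (contDiff_const (c := (2 * Real.pi)⁻¹ • ξ)))) (h.smooth ⊤) ζ
    (n := n) (by exact_mod_cast le_top)
  refine (mul_le_mul_of_nonneg_left hle (by positivity)).trans ?_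
  rw [Finset.mul_sum, Finset.sum_mul]
  refine Finset.sum_le_sum fun i hi => ?_
  have h1 : ‖iteratedFDeriv ℝ i
      (fun ζ => weight P (-t) ((2 * Real.pi) • (ζ + (2 * Real.pi)⁻¹ • ξ))) ζ‖ ≤
      A i * (c * (B * (1 + ‖ζ‖) ^ N) * weight P (-t) ξ) := by
    refine (hA i _ ζ).trans (mul_le_mul_of_nonneg_left ?_ (hA0 i))
    rw [two_pi_smul_add]
    refine (weight_neg_add_le P ht _ ξ).trans ?_
    gcongr
    exact hB' ζ
  have h2 : (1 + ‖ζ‖) ^ (k + N) * ‖iteratedFDeriv ℝ (n - i) h ζ‖ ≤ S :=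
    SchwartzMap.one_add_le_sup_seminorm_apply (𝕜 := ℂ) (m := (k + N, n)) le_rfl (Nat.sub_le _ _)
      h ζ
  have h3 : ‖ζ‖ ^ k ≤ (1 + ‖ζ‖) ^ k := by gcongr; linarith
  have hAi := hA0 i
  calc _ ≤ (1 + ‖ζ‖) ^ k * ((n.choose i : ℝ) * (A i * (c * (B * (1 + ‖ζ‖) ^ N) *
        weight P (-t) ξ)) * ‖iteratedFDeriv ℝ (n - i) h ζ‖) := by
        gcongr
        exact h1
    _ = (n.choose i : ℝ) * A i * c * B * weight P (-t) ξ *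
        ((1 + ‖ζ‖) ^ (k + N) * ‖iteratedFDeriv ℝ (n - i) h ζ‖) := by rw [pow_add]; ring
    _ ≤ (n.choose i : ℝ) * A i * c * B * weight P (-t) ξ * S := by gcongr
    _ = _ := by ring

/-- The Schwartz function `x ↦ exp (i⟨x, ξ⟩) ⟨⟨D⟩⟩^t (exp (-i⟨·, ξ⟩) χ) (x)`. The direct and the
inverse Fourier transform can be exchanged, since the weight is even; this order is the one that
occurs in the action of multipliers on distributions. -/
noncomputable def kernel (P : ∀ j, E →L[ℝ] G j) (t : ι → ℝ) (χ : 𝓢(E, ℂ)) (ξ : E) : 𝓢(E, ℂ) :=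
  𝓕 (shiftedProduct P t (𝓕⁻ χ) ξ)

theorem kernel_apply (P : ∀ j, E →L[ℝ] G j) (t : ι → ℝ) (χ : 𝓢(E, ℂ)) (ξ x : E) :
    kernel P t χ ξ x = ∫ ζ, Complex.exp (↑(-2 * Real.pi * inner ℝ ζ x) * Complex.I) *
      (weight P t ((2 * Real.pi) • ζ + ξ) * (𝓕⁻ χ) ζ) := by
  rw [kernel, SchwartzMap.fourier_coe, Real.fourier_eq']
  refine integral_congr_ae (.of_forall fun ζ => ?_)
  simp only [shiftedProduct_apply, smul_eq_mul, Complex.real_smul]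

/-- The `L¹` norms of the kernels decay like the weight of negative exponent: the `L¹` norm of the
Fourier transform is a continuous seminorm on the Schwartz space. -/
theorem exists_eLpNorm_kernel_le (P : ∀ j, E →L[ℝ] G j) {t : ι → ℝ} (ht : ∀ j, 0 ≤ t j)
    (χ : 𝓢(E, ℂ)) :
    ∃ C : ℝ≥0, ∀ ξ : E,
      eLpNorm (kernel P (-t) χ ξ) 1 ≤ C * ENNReal.ofReal (weight P (-t) ξ) := by
  let T : 𝓢(E, ℂ) →L[ℂ] Lp ℂ 1 (volume : Measure E) :=
    (SchwartzMap.toLpCLM ℂ ℂ 1 volume).comp (SchwartzMap.fourierTransformCLM ℂ)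
  obtain ⟨s, C, -, hC⟩ := Seminorm.bound_of_continuous (schwartz_withSeminorms ℂ E ℂ)
    ((normSeminorm ℂ (Lp ℂ 1 (volume : Measure E))).comp T.toLinearMap)
    (continuous_norm.comp T.continuous)
  choose D hD0 hD using fun m : ℕ × ℕ => exists_seminorm_shiftedProduct_le P ht (𝓕⁻ χ) m.1 m.2
  refine ⟨C * (∑ m ∈ s, D m).toNNReal, fun ξ => ?_⟩
  have h1 : ‖(kernel P (-t) χ ξ).toLp 1 volume‖ ≤
      C * (s.sup (schwartzSeminormFamily ℂ E ℂ)) (shiftedProduct P (-t) (𝓕⁻ χ) ξ) :=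
    hC (shiftedProduct P (-t) (𝓕⁻ χ) ξ)
  have hw := (weight_pos P (-t) ξ).le
  have hs : 0 ≤ ∑ m ∈ s, D m := Finset.sum_nonneg fun m _ => hD0 m
  have h2 : (s.sup (schwartzSeminormFamily ℂ E ℂ)) (shiftedProduct P (-t) (𝓕⁻ χ) ξ) ≤
      (∑ m ∈ s, D m) * weight P (-t) ξ := by
    refine Seminorm.finset_sup_apply_le (mul_nonneg hs hw) fun m hm => ?_
    refine (hD m ξ).trans ?_
    gcongr
    exact Finset.single_le_sum (fun m _ => hD0 m) hm
  have h3 : eLpNorm (kernel P (-t) χ ξ) 1 =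
      ENNReal.ofReal ‖(kernel P (-t) χ ξ).toLp 1 volume‖ := by
    rw [SchwartzMap.norm_toLp, ENNReal.ofReal_toReal (SchwartzMap.eLpNorm_lt_top _ _ _).ne]
  rw [h3]
  refine (ENNReal.ofReal_le_ofReal (h1.trans (mul_le_mul_of_nonneg_left h2 C.2))).trans
    (le_of_eq ?_)
  rw [ENNReal.ofReal_mul C.coe_nonneg, ENNReal.ofReal_mul hs, ENNReal.coe_mul, mul_assoc,
    ENNReal.ofReal_coe_nnreal]
  rfl

theorem continuous_kernel_integrand (P : ∀ j, E →L[ℝ] G j) (t : ι → ℝ) (χ : 𝓢(E, ℂ)) :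
    Continuous fun q : (E × E) × E =>
      Complex.exp (↑(-2 * Real.pi * inner ℝ q.2 q.1.2) * Complex.I) *
        (weight P t ((2 * Real.pi) • q.2 + q.1.1) * (𝓕⁻ χ) q.2) := by
  have h1 := continuous_weight P t
  have h2 := (𝓕⁻ χ).continuous
  have h3 : Continuous fun q : (E × E) × E => weight P t ((2 * Real.pi) • q.2 + q.1.1) :=
    h1.comp (by fun_prop)
  have h4 : Continuous fun q : (E × E) × E => (𝓕⁻ χ) q.2 := h2.comp continuous_snd
  have h5 : Continuous fun q : (E × E) × E => (inner ℝ q.2 q.1.2 : ℝ) :=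
    continuous_snd.inner (continuous_snd.comp continuous_fst)
  fun_prop

theorem stronglyMeasurable_kernel (P : ∀ j, E →L[ℝ] G j) (t : ι → ℝ) (χ : 𝓢(E, ℂ)) :
    StronglyMeasurable fun q : E × E => kernel P t χ q.1 q.2 := by
  have h := (continuous_kernel_integrand P t χ).stronglyMeasurable.integral_prod_right'
    (ν := (volume : Measure E))
  refine Eq.mp (congrArg _ (funext fun q => ?_)) h
  rw [kernel_apply]

theorem fourierInv_modTrans (χ : TestFn E) (y ξ η : E) :
    (𝓕⁻ (toSchwartz (modTrans χ y ξ))) (η + (2 * Real.pi)⁻¹ • ξ) =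
      Complex.exp (↑(2 * Real.pi * inner ℝ y η) * Complex.I) * (𝓕⁻ (toSchwartz χ)) η := by
  rw [SchwartzMap.fourierInv_coe, SchwartzMap.fourierInv_coe, Real.fourierInv_eq',
    Real.fourierInv_eq', ← integral_add_right_eq_self _ y, ← integral_const_mul]
  refine integral_congr_ae (.of_forall fun v => ?_)
  simp only [toSchwartz_apply, smul_eq_mul]
  change _ * (Complex.exp (-Complex.I * (inner ℝ (v + y) ξ : ℝ)) * χ (v + y - y)) = _
  rw [add_sub_cancel_right, ← mul_assoc, ← mul_assoc, ← Complex.exp_add, ← Complex.exp_add]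
  congr 2
  have hpi : (Real.pi : ℂ) ≠ 0 := by exact_mod_cast Real.pi_ne_zero
  simp only [inner_add_left, inner_add_right, inner_smul_right]
  push_cast
  field_simp
  ring

/-- The Fourier multiplier commutes with translations and is shifted by modulations. -/
theorem multiplier_modTrans (P : ∀ j, E →L[ℝ] G j) (t : ι → ℝ) (χ : TestFn E) (y ξ x : E) :
    (𝓕 (SchwartzMap.smulLeftCLM ℂ (fun ζ : E => (weight P t ((2 * Real.pi) • ζ) : ℂ))
      (𝓕⁻ (toSchwartz (modTrans χ y ξ))))) x =
    Complex.exp (-Complex.I * (inner ℝ x ξ : ℝ)) * kernel P t (toSchwartz χ) ξ (x - y) := by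
  rw [kernel_apply, SchwartzMap.fourier_coe, Real.fourier_eq',
    ← integral_add_right_eq_self _ ((2 * Real.pi)⁻¹ • ξ), ← integral_const_mul]
  refine integral_congr_ae (.of_forall fun ζ => ?_)
  simp only
  rw [SchwartzMap.smulLeftCLM_apply_apply (hasTemperateGrowth_weight P t), fourierInv_modTrans,
    two_pi_smul_add]
  simp only [smul_eq_mul]
  have hpi : (Real.pi : ℂ) ≠ 0 := by exact_mod_cast Real.pi_ne_zero
  have hexp : Complex.exp (↑(-2 * Real.pi * inner ℝ (ζ + (2 * Real.pi)⁻¹ • ξ) x) * Complex.I) *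
      Complex.exp (↑(2 * Real.pi * inner ℝ y ζ) * Complex.I) =
      Complex.exp (-Complex.I * (inner ℝ x ξ : ℝ)) *
        Complex.exp (↑(-2 * Real.pi * inner ℝ ζ (x - y)) * Complex.I) := by
    rw [← Complex.exp_add, ← Complex.exp_add]
    congr 1
    simp only [inner_add_left, inner_sub_right, inner_smul_left, real_inner_comm ξ x,
      real_inner_comm ζ y]
    simp only [conj_trivial]
    push_cast
    field_simp
    ring
  linear_combination (weight P t ((2 * Real.pi) • ζ + ξ) * (𝓕⁻ (toSchwartz χ)) ζ) * hexp

end Kernel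


/-! ### Young's inequality -/

section Young

variable {α : Type*} [MeasurableSpace α]

/-- Jensen's inequality for the power `r ≥ 1` and the measure with density `g`, which need not be
a probability measure. -/
theorem lintegral_mul_rpow_le (μ : Measure α) {f g : α → ℝ≥0∞} (hf : Measurable f)
    (hg : Measurable g) {r : ℝ} (hr : 1 ≤ r) :
    (∫⁻ x, f x * g x ∂μ) ^ r ≤ (∫⁻ x, f x ^ r * g x ∂μ) * (∫⁻ x, g x ∂μ) ^ (r - 1) := by
  have h0 : 0 < r := one_pos.trans_le hr
  have h := eLpNorm'_le_eLpNorm'_mul_rpow_measure_univ (μ := μ.withDensity g) (f := f) one_pos hr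
    hf.aestronglyMeasurable
  have h2 := ENNReal.rpow_le_rpow h h0.le
  simp only [eLpNorm'_eq_lintegral_enorm, enorm_eq_self, ENNReal.rpow_one, div_one] at h2
  rw [ENNReal.mul_rpow_of_nonneg _ _ h0.le, ← ENNReal.rpow_mul, ← ENNReal.rpow_mul,
    one_div_mul_cancel h0.ne', ENNReal.rpow_one,
    lintegral_withDensity_eq_lintegral_mul _ hg hf,
    lintegral_withDensity_eq_lintegral_mul _ hg (hf.pow_const r),
    withDensity_apply _ MeasurableSet.univ, Measure.restrict_univ, sub_mul,
    one_div_mul_cancel h0.ne', one_mul] at h2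
  simpa only [Pi.mul_apply, mul_comm] using h2

variable {E : Type*} [AddCommGroup E] [MeasurableSpace E] [MeasurableAdd₂ E] [MeasurableNeg E]

/-- Young's inequality for the correlation of `f` and `g` and a finite exponent. -/
theorem lintegral_rpow_lintegral_mul_sub_le (μ : Measure E) [SFinite μ] [μ.IsAddLeftInvariant]
    [μ.IsNegInvariant] {f g : E → ℝ≥0∞} (hf : Measurable f) (hg : Measurable g) {r : ℝ}
    (hr : 1 ≤ r) :
    ∫⁻ y, (∫⁻ x, f x * g (x - y) ∂μ) ^ r ∂μ ≤ (∫⁻ x, f x ^ r ∂μ) * (∫⁻ x, g x ∂μ) ^ r := by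
  have hg2 : Measurable fun q : E × E => g (q.2 - q.1) :=
    hg.comp (measurable_snd.sub measurable_fst)
  have hsub : ∀ y, ∫⁻ x, g (x - y) ∂μ = ∫⁻ x, g x ∂μ := fun y => lintegral_sub_right_eq_self g y
  calc ∫⁻ y, (∫⁻ x, f x * g (x - y) ∂μ) ^ r ∂μ
      ≤ ∫⁻ y, (∫⁻ x, f x ^ r * g (x - y) ∂μ) * (∫⁻ x, g x ∂μ) ^ (r - 1) ∂μ := by
        refine lintegral_mono fun y => ?_
        rw [← hsub y]
        exact lintegral_mul_rpow_le μ hf (hg.comp (measurable_id.sub_const y)) hr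
    _ = (∫⁻ y, ∫⁻ x, f x ^ r * g (x - y) ∂μ ∂μ) * (∫⁻ x, g x ∂μ) ^ (r - 1) := by
        refine lintegral_mul_const _ (Measurable.lintegral_prod_right ?_)
        exact ((hf.comp measurable_snd).pow_const r).mul hg2
    _ = (∫⁻ x, ∫⁻ y, f x ^ r * g (x - y) ∂μ ∂μ) * (∫⁻ x, g x ∂μ) ^ (r - 1) := by
        rw [lintegral_lintegral_swap]
        exact (((hf.comp measurable_snd).pow_const r).mul hg2).aemeasurable
    _ = (∫⁻ x, f x ^ r ∂μ) * (∫⁻ x, g x ∂μ) * (∫⁻ x, g x ∂μ) ^ (r - 1) := by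
        congr 1
        rw [← lintegral_mul_const _ (hf.pow_const r)]
        refine lintegral_congr fun x => ?_
        rw [lintegral_const_mul _ (show Measurable fun y => g (x - y) from
            hg.comp (measurable_id.const_sub x)),
          lintegral_sub_left_eq_self g x]
    _ = _ := by
        rw [mul_assoc]
        congr 1
        nth_rw 1 [← ENNReal.rpow_one (∫⁻ x, g x ∂μ)]
        rw [← ENNReal.rpow_add_of_nonneg _ _ zero_le_one (by linarith), add_sub_cancel]

/-- Young's inequality for the correlation of `f` and `g` and the exponent `∞`. -/
theorem lintegral_enorm_mul_sub_le {F : Type*} [NormedAddCommGroup F] (μ : Measure E)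
    [μ.IsAddLeftInvariant] [SFinite μ] (f : E → F) {g : E → ℝ≥0∞} (hg : Measurable g) (y : E) :
    ∫⁻ x, ‖f x‖ₑ * g (x - y) ∂μ ≤ eLpNorm f ∞ μ * ∫⁻ x, g x ∂μ := by
  rw [← lintegral_sub_right_eq_self g y,
    ← lintegral_const_mul _ (show Measurable fun x => g (x - y) from
      hg.comp (measurable_id.sub_const y)), eLpNorm_exponent_top]
  refine lintegral_mono_ae ?_
  filter_upwards [enorm_ae_le_eLpNormEssSup f μ] with x hx
  gcongr

end Young

/-! ### Translates of Schwartz functions integrated against bounded functions -/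

section Translation

variable {E : Type*} [NormedAddCommGroup E] [NormedSpace ℝ E] [FiniteDimensional ℝ E]
  [MeasurableSpace E] [BorelSpace E]

theorem continuous_integral_mul_translate (μ : Measure E) [μ.IsAddHaarMeasure] {f : E → ℂ}
    (hf : AEStronglyMeasurable f μ) {M : ℝ} (hM : ∀ᵐ x ∂μ, ‖f x‖ ≤ M) (g : 𝓢(E, ℂ)) :
    Continuous fun y => ∫ x, f x * g (x - y) ∂μ := by
  set N : ℕ := Module.finrank ℝ E + 1 with hN
  set S : ℝ := 2 ^ N * (Finset.Iic (N, 0)).sup (fun m => SchwartzMap.seminorm ℝ m.1 m.2) g with hS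
  have hgS : ∀ z, (1 + ‖z‖) ^ N * ‖g z‖ ≤ S := fun z => by
    simpa using SchwartzMap.one_add_le_sup_seminorm_apply (𝕜 := ℝ) (m := (N, 0)) le_rfl le_rfl g z
  refine continuous_iff_continuousAt.2 fun y₀ => ?_
  -- For `‖y - y₀‖ < 1`, the decay of `g` gives a bound independent of `y`, as
  -- `1 + ‖x‖ ≤ (1 + ‖x - y‖) (2 + ‖y₀‖)`.
  refine continuousAt_of_dominated
    (bound := fun x => M * (S * (2 + ‖y₀‖) ^ N) * (1 + ‖x‖) ^ (-(N : ℝ))) ?_ ?_ ?_ ?_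
  · exact .of_forall fun y =>
      hf.mul (g.continuous.comp (continuous_id.sub continuous_const)).aestronglyMeasurable
  · filter_upwards [Metric.ball_mem_nhds y₀ one_pos] with y hy
    filter_upwards [hM] with x hx
    have hM0 : 0 ≤ M := (norm_nonneg _).trans hx
    rw [norm_mul, mul_assoc M]
    refine mul_le_mul hx ?_ (norm_nonneg _) hM0
    have hy' : ‖y‖ ≤ ‖y₀‖ + 1 := by
      have h1 := norm_sub_norm_le y y₀
      rw [mem_ball_iff_norm] at hy
      linarith
    have hx' : ‖x‖ ≤ ‖x - y‖ + ‖y‖ := by simpa using norm_add_le (x - y) y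
    have h2 : (1 + ‖x‖) ^ N ≤ (1 + ‖x - y‖) ^ N * (2 + ‖y₀‖) ^ N := by
      rw [← mul_pow]
      gcongr
      nlinarith [norm_nonneg (x - y), norm_nonneg y₀,
        mul_nonneg (norm_nonneg (x - y)) (norm_nonneg y₀)]
    rw [Real.rpow_neg (by positivity), Real.rpow_natCast, ← div_eq_mul_inv,
      le_div_iff₀ (by positivity)]
    calc ‖g (x - y)‖ * (1 + ‖x‖) ^ N ≤
        ‖g (x - y)‖ * ((1 + ‖x - y‖) ^ N * (2 + ‖y₀‖) ^ N) := by gcongr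
      _ = (1 + ‖x - y‖) ^ N * ‖g (x - y)‖ * (2 + ‖y₀‖) ^ N := by ring
      _ ≤ S * (2 + ‖y₀‖) ^ N := by gcongr; exact hgS _
  · exact (integrable_one_add_norm (by rw [hN]; push_cast; linarith)).const_mul _
  · exact .of_forall fun x => (continuous_const.mul
      (g.continuous.comp (continuous_const.sub continuous_id))).continuousAt

end Translation

/-! ### Integrability of the weight -/

section WeightIntegrable

variable {E : Type*} [NormedAddCommGroup E] [InnerProductSpace ℝ E] [FiniteDimensional ℝ E]
  [MeasurableSpace E] [BorelSpace E]
  {ι : Type*} [Fintype ι] {G : ι → Type*} [∀ j, NormedAddCommGroup (G j)]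
  [∀ j, InnerProductSpace ℝ (G j)] [∀ j, FiniteDimensional ℝ (G j)]

/-- If the components identify `E` with the product of the spaces `G j`, Lebesgue measure on `E` is
a multiple of the product measure, and the weight is a product of integrable functions. -/
theorem integrable_weight_neg (P : ∀ j, E →L[ℝ] G j) (T : E ≃L[ℝ] (∀ j, G j))
    (hT : ∀ ξ j, T ξ j = P j ξ) {t : ι → ℝ} (ht : ∀ j, (Module.finrank ℝ (G j) : ℝ) < t j) :
    Integrable (weight P (-t)) := by
  let _ : ∀ j, MeasurableSpace (G j) := fun j => borel (G j)
  have : ∀ j, BorelSpace (G j) := fun j => ⟨rfl⟩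
  have h1 : Integrable (fun z : ∀ j, G j => ∏ j, (1 + ‖z j‖ ^ 2) ^ (-t j / 2))
      (Measure.pi fun j => (volume : Measure (G j))) :=
    Integrable.fintype_prod_dep (f := fun j (x : G j) => ((1 + ‖x‖ ^ 2) ^ (-t j / 2) : ℝ))
      fun j => integrable_rpow_neg_one_add_norm_sq (ht j)
  have : (Measure.map T (volume : Measure E)).IsAddHaarMeasure := T.isAddHaarMeasure_map volume
  have h2 : Integrable (fun z : ∀ j, G j => ∏ j, (1 + ‖z j‖ ^ 2) ^ (-t j / 2))
      (Measure.map T (volume : Measure E)) := by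
    rw [Measure.isAddLeftInvariant_eq_smul (Measure.map T (volume : Measure E))
      (Measure.pi fun j => (volume : Measure (G j)))]
    exact h1.smul_measure ENNReal.coe_ne_top
  have h3 := (T.toHomeomorph.measurableEmbedding.integrable_map_iff
    (μ := (volume : Measure E))).1 h2
  refine h3.congr (.of_forall fun ξ => ?_)
  change ∏ j, (1 + ‖T ξ j‖ ^ 2) ^ (-t j / 2) = _
  simp only [hT]
  rfl

end WeightIntegrable

/-! ### Density of the test functions in the Schwartz space -/

section Density

variable {E : Type*} [NormedAddCommGroup E] [InnerProductSpace ℝ E] [FiniteDimensional ℝ E]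

/-- The derivatives of `ρ - 1`, for a cutoff function `ρ` equal to `1` on the unit ball, are
bounded and vanish in the ball, so that they are bounded by multiples of `‖x‖`. -/
theorem exists_norm_iteratedFDeriv_cutoff_sub_one_le (ρ : ContDiffBump (0 : E)) (hρ : ρ.rIn = 1)
    (i : ℕ) :
    ∃ A : ℝ, 0 ≤ A ∧ ∀ x, ‖iteratedFDeriv ℝ i (fun x => ρ x - 1) x‖ ≤ A * ‖x‖ := by
  have hsm : ContDiff ℝ ((⊤ : ℕ∞) : WithTop ℕ∞) ρ := ρ.contDiff
  have hbd : ∃ B : ℝ, ∀ x, ‖iteratedFDeriv ℝ i (fun x => ρ x - 1) x‖ ≤ B := by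
    obtain ⟨B, hB⟩ := (hsm.continuous_iteratedFDeriv (m := i)
      (by exact_mod_cast le_top)).bounded_above_of_compact_support
      (ρ.hasCompactSupport.iteratedFDeriv i)
    refine ⟨B + 1, fun x => ?_⟩
    have h1 : iteratedFDeriv ℝ i (fun x => ρ x - 1) x =
        iteratedFDeriv ℝ i ρ x - iteratedFDeriv ℝ i (fun _ : E => (1 : ℝ)) x :=
      iteratedFDeriv_sub_apply (hsm.of_le (by exact_mod_cast le_top)).contDiffAt
        contDiff_const.contDiffAt
    rw [h1]
    refine (norm_sub_le _ _).trans (add_le_add (hB x) ?_)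
    rcases i with _ | i
    · simp
    · rw [iteratedFDeriv_const_of_ne (Nat.succ_ne_zero i)]
      simp
  obtain ⟨B, hB⟩ := hbd
  have hB0 : 0 ≤ B := (norm_nonneg _).trans (hB 0)
  refine ⟨B, hB0, fun x => ?_⟩
  by_cases hx : ‖x‖ < 1
  · have h0 : (fun x => ρ x - 1) =ᶠ[nhds x] fun _ => (0 : ℝ) := by
      filter_upwards [ρ.eventuallyEq_one_of_mem_ball (x := x) (by simpa [hρ] using hx)] with z hz
      simp [hz]
    have h1 : iteratedFDeriv ℝ i (fun x => ρ x - 1) x = 0 := by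
      rw [(h0.iteratedFDeriv ℝ i).self_of_nhds]
      rcases i with _ | i
      · ext; simp
      · rw [iteratedFDeriv_const_of_ne (Nat.succ_ne_zero i)]
        rfl
    rw [h1, norm_zero]
    positivity
  · exact (hB x).trans (le_mul_of_one_le_right hB0 (not_lt.1 hx))

/-- The product of a Schwartz function and a dilated cutoff function. -/
noncomputable def cutoffMul (ρ : ContDiffBump (0 : E)) (φ : 𝓢(E, ℂ)) (n : ℕ) : TestFn E where
  toFun x := ρ (((n : ℝ) + 1)⁻¹ • x) • φ x
  contDiff' := (ρ.contDiff.comp (contDiff_const.smul contDiff_id)).smul (φ.smooth _)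
  hasCompactSupport' := by
    have h : HasCompactSupport fun x : E => ρ (((n : ℝ) + 1)⁻¹ • x) :=
      ρ.hasCompactSupport.comp_homeomorph
        (Homeomorph.smulOfNeZero (((n : ℝ) + 1)⁻¹) (by positivity))
    exact h.smul_right
  tsupport_subset' := fun _ _ => trivial

/-- The derivatives of `ρ (x / (n + 1)) - 1` are `O(‖x‖ / n)`; the factor `‖x‖` is absorbed by the
next Schwartz seminorm of `φ`. -/
theorem tendsto_toSchwartz_cutoffMul (ρ : ContDiffBump (0 : E)) (hρ : ρ.rIn = 1) (φ : 𝓢(E, ℂ)) :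
    Filter.Tendsto (fun n => toSchwartz (cutoffMul ρ φ n)) Filter.atTop (nhds φ) := by
  rw [(schwartz_withSeminorms ℝ E ℂ).tendsto_nhds]
  rintro ⟨k, m⟩ ε hε
  choose A hA0 hA using exists_norm_iteratedFDeriv_cutoff_sub_one_le ρ hρ
  set C : ℝ := ∑ i ∈ Finset.range (m + 1),
    (m.choose i : ℝ) * A i * SchwartzMap.seminorm ℝ (k + 1) (m - i) φ with hC
  have hC0 : 0 ≤ C := Finset.sum_nonneg fun i _ => by have := hA0 i; positivity
  have hsm : ContDiff ℝ ((⊤ : ℕ∞) : WithTop ℕ∞) (fun x => ρ x - 1) :=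
    ρ.contDiff.sub contDiff_const
  have key : ∀ n : ℕ, SchwartzMap.seminorm ℝ k m (toSchwartz (cutoffMul ρ φ n) - φ) ≤
      C * ((n : ℝ) + 1)⁻¹ := by
    intro n
    set c : ℝ := ((n : ℝ) + 1)⁻¹ with hc
    have hc0 : 0 ≤ c := by positivity
    have hc1 : c ≤ 1 := inv_le_one_of_one_le₀ (by linarith [(Nat.cast_nonneg n : (0 : ℝ) ≤ n)])
    refine SchwartzMap.seminorm_le_bound ℝ k m _ (by positivity) fun x => ?_
    have hfun : (⇑(toSchwartz (cutoffMul ρ φ n) - φ) : E → ℂ) =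
        fun x => (ρ (c • x) - 1) • φ x := by
      ext1 x
      rw [sub_smul, one_smul]
      rfl
    rw [hfun]
    have hdil : ∀ i, ‖iteratedFDeriv ℝ i (fun x => ρ (c • x) - 1) x‖ ≤ A i * ‖x‖ * c := by
      intro i
      have h1 := iteratedFDeriv_comp_const_smul (𝕜 := ℝ) (f := fun x => ρ x - 1) (i := i)
        c (hsm.of_le (by exact_mod_cast le_top))
      have h2 := congrFun h1 x
      rw [h2, norm_smul, norm_pow, Real.norm_of_nonneg hc0]
      calc c ^ i * ‖iteratedFDeriv ℝ i (fun x => ρ x - 1) (c • x)‖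
          ≤ 1 * (A i * ‖c • x‖) := by
            gcongr
            · exact pow_le_one₀ hc0 hc1
            · exact hA i _
        _ = _ := by rw [norm_smul, Real.norm_of_nonneg hc0]; ring
    have hle := norm_iteratedFDeriv_smul_le (𝕜 := ℝ)
      (hsm.comp (contDiff_const.smul contDiff_id : ContDiff ℝ _ fun x : E => c • x))
      (φ.smooth ⊤) x (n := m) (by exact_mod_cast le_top)
    refine (mul_le_mul_of_nonneg_left hle (by positivity)).trans ?_
    rw [Finset.mul_sum, Finset.sum_mul]
    refine Finset.sum_le_sum fun i _ => ?_
    have hAi := hA0 i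
    calc _ ≤ ‖x‖ ^ k * ((m.choose i : ℝ) * (A i * ‖x‖ * c) *
          ‖iteratedFDeriv ℝ (m - i) φ x‖) := by
          gcongr
          exact hdil i
      _ = (m.choose i : ℝ) * A i * (‖x‖ ^ (k + 1) * ‖iteratedFDeriv ℝ (m - i) φ x‖) * c := by
          ring
      _ ≤ _ := by
          gcongr
          exact SchwartzMap.le_seminorm ℝ (k + 1) (m - i) φ x
  have hlim : Filter.Tendsto (fun n : ℕ => C * ((n : ℝ) + 1)⁻¹) Filter.atTop (nhds 0) := by
    simpa [one_div] using (tendsto_one_div_add_atTop_nhds_zero_nat (𝕜 := ℝ)).const_mul C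
  filter_upwards [hlim.eventually_lt_const hε] with n hn
  exact (key n).trans_lt hn

/-- A tempered distribution is determined by its restriction to the test functions. -/
theorem restrict_injective : Function.Injective (restrict : 𝓢'(E, ℂ) → Distr E) := by
  intro u v huv
  let ρ : ContDiffBump (0 : E) := ⟨1, 2, one_pos, one_lt_two⟩
  ext φ
  have h := tendsto_toSchwartz_cutoffMul ρ rfl φ
  have hu := (u.continuous.tendsto φ).comp h
  have hv := (v.continuous.tendsto φ).comp h
  refine tendsto_nhds_unique hu (hv.congr fun n => ?_)
  exact (DFunLike.congr_fun huv (cutoffMul ρ φ n)).symm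

end Density


/-! ### Suprema, test functions and orthogonal decompositions -/

section Auxiliary

theorem measurable_iSup_enorm_of_continuous {X Y : Type*} [MeasurableSpace X]
    [TopologicalSpace Y] [SeparableSpace Y] [Nonempty Y] {Φ : Y → X → ℂ}
    (hc : ∀ ξ, Continuous fun y => Φ y ξ)
    (hm : ∀ y, Measurable (Φ y)) : Measurable fun ξ => ⨆ y, ‖Φ y ξ‖ₑ := by
  -- By continuity, the supremum is one over a countable dense set.
  have hsup : (fun ξ : X => ⨆ y : Y, ‖Φ y ξ‖ₑ) = fun ξ => ⨆ n : ℕ, ‖Φ (denseSeq Y n) ξ‖ₑ := by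
    ext1 ξ
    refine le_antisymm (iSup_le fun y => ?_)
      (iSup_le fun n => le_iSup (fun y => ‖Φ y ξ‖ₑ) _)
    exact (denseRange_denseSeq Y).induction_on
      (p := fun y => ‖Φ y ξ‖ₑ ≤ ⨆ n : ℕ, ‖Φ (denseSeq Y n) ξ‖ₑ) y
      (isClosed_le (hc ξ).enorm continuous_const)
      fun n => le_iSup (fun n => ‖Φ (denseSeq Y n) ξ‖ₑ) n
  rw [hsup]
  exact Measurable.iSup fun n => (hm _).enorm

variable {E : Type*} [NormedAddCommGroup E] [InnerProductSpace ℝ E] [FiniteDimensional ℝ E]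

theorem exists_testFn_ne_zero : ∃ χ : TestFn E, χ ≠ 0 := by
  let ρ : ContDiffBump (0 : E) := ⟨1, 2, one_pos, one_lt_two⟩
  refine ⟨⟨fun x => (ρ x : ℂ), Complex.ofRealCLM.contDiff.comp ρ.contDiff,
    ρ.hasCompactSupport.comp_left Complex.ofReal_zero, fun _ _ => trivial⟩, fun h => ?_⟩
  have h0 : (ρ 0 : ℂ) = 0 := DFunLike.congr_fun h (0 : E)
  rw [ρ.one_of_mem_closedBall (by simp [ρ])] at h0
  simp at h0

/-- The orthogonal projections onto the summands of an orthogonal decomposition identify the space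
with the product of the summands. -/
theorem exists_equiv_orthogonalProjection {ι : Type*} [Fintype ι] [DecidableEq ι]
    (V : ι → Submodule ℝ E)
    (hV : DirectSum.IsInternal V)
    (hO : OrthogonalFamily ℝ (fun j => V j) fun j => (V j).subtypeₗᵢ) :
    ∃ T : E ≃L[ℝ] (∀ j, V j), ∀ ξ j, T ξ j = (V j).orthogonalProjectionOnto ξ := by
  let L : E →ₗ[ℝ] (∀ j, V j) :=
    LinearMap.pi fun j => ((V j).orthogonalProjectionOnto : E →ₗ[ℝ] V j)
  have hinj : Function.Injective L := by
    rw [← LinearMap.ker_eq_bot, LinearMap.ker_eq_bot']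
    intro ξ hξ
    have h1 : ∀ j, ξ ∈ (V j)ᗮ := fun j =>
      Submodule.orthogonalProjectionOnto_eq_zero_iff.1 (congrFun hξ j)
    have h2 : (⨆ j, V j) ≤ (ℝ ∙ ξ)ᗮ := iSup_le fun j v hv =>
      Submodule.mem_orthogonal_singleton_iff_inner_left.2 (h1 j v hv)
    rw [hV.submodule_iSup_eq_top] at h2
    exact inner_self_eq_zero.1
      (Submodule.mem_orthogonal_singleton_iff_inner_left.1 (h2 (Submodule.mem_top (x := ξ))))
  have hsurj : Function.Surjective L := by
    intro v
    refine ⟨∑ i, (v i : E), funext fun j => ?_⟩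
    change (V j).orthogonalProjectionOnto (∑ i, (v i : E)) = v j
    rw [map_sum, Finset.sum_eq_single j]
    · exact Submodule.orthogonalProjectionOnto_mem_subspace_eq_self (v j)
    · intro i _ hij
      refine Submodule.orthogonalProjectionOnto_eq_zero_iff.2 ?_
      exact fun w hw => hO hij.symm ⟨w, hw⟩ (v i)
    · simp
  exact ⟨(LinearEquiv.ofBijective L ⟨hinj, hsurj⟩).toContinuousLinearEquiv, fun ξ j => rfl⟩

end Auxiliary

/-! ### The embedding -/

section Embedding

open FourierTransform

variable {E : Type*} [NormedAddCommGroup E] [InnerProductSpace ℝ E] [FiniteDimensional ℝ E]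
  [MeasurableSpace E] [BorelSpace E]
  {ι : Type*} [Fintype ι] {G : ι → Type*} [∀ j, NormedAddCommGroup (G j)]
  [∀ j, InnerProductSpace ℝ (G j)]

/-- The transpose of `⟨⟨D⟩⟩^(-t)`, applied to the test function, undoes `⟨⟨D⟩⟩^t`. -/
theorem apply_eq_bessel_apply (P : ∀ j, E →L[ℝ] G j) (t : ι → ℝ) (u : 𝓢'(E, ℂ)) (φ : 𝓢(E, ℂ)) :
    u φ = bessel P t u (𝓕 (SchwartzMap.smulLeftCLM ℂ
      (fun ζ : E => (weight P (-t) ((2 * Real.pi) • ζ) : ℂ)) (𝓕⁻ φ))) := by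
  rw [bessel, fourierMultiplierCLM_apply_apply, FourierPair.fourierInv_fourier_eq,
    SchwartzMap.smulLeftCLM_smulLeftCLM_apply (hasTemperateGrowth_weight P t)
      (hasTemperateGrowth_weight P (-t))]
  have h1 : ((fun ζ : E => (weight P t ((2 * Real.pi) • ζ) : ℂ)) *
      fun ζ : E => (weight P (-t) ((2 * Real.pi) • ζ) : ℂ)) = fun _ => 1 := by
    ext1 ζ
    rw [Pi.mul_apply, ← Complex.ofReal_mul, weight_mul_weight_neg, Complex.ofReal_one]
  rw [h1, SchwartzMap.smulLeftCLM_const]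
  simp

/-- The localized Fourier transform of `u` is, up to factors of modulus one, the correlation of
`⟨⟨D⟩⟩^t u` with a kernel. -/
theorem localFourier_eq_integral {p : ℝ≥0∞} [Fact (1 ≤ p)] (P : ∀ j, E →L[ℝ] G j) (t : ι → ℝ)
    {u : 𝓢'(E, ℂ)} {f : Lp ℂ p (volume : Measure E)}
    (hf : Lp.toTemperedDistribution f = bessel P t u) (χ : TestFn E) (y ξ : E) :
    localFourier (restrict u) χ y ξ = ∫ x, f x * Complex.exp (-Complex.I * (inner ℝ x ξ : ℝ)) *
      kernel P (-t) (toSchwartz χ) ξ (x - y) := by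
  change u (toSchwartz (modTrans χ y ξ)) = _
  rw [apply_eq_bessel_apply P t, ← hf, Lp.toTemperedDistribution_apply]
  refine integral_congr_ae (.of_forall fun x => ?_)
  simp only [multiplier_modTrans, smul_eq_mul]
  ring

theorem enorm_exp_neg_I_mul (a : ℝ) : ‖Complex.exp (-Complex.I * a)‖ₑ = 1 := by
  rw [← ofReal_norm, show -Complex.I * (a : ℂ) = ((-a : ℝ) : ℂ) * Complex.I by push_cast; ring,
    Complex.norm_exp_ofReal_mul_I, ENNReal.ofReal_one]

theorem stronglyMeasurable_modulation :
    StronglyMeasurable fun q : E × E => Complex.exp (-Complex.I * (inner ℝ q.1 q.2 : ℝ)) := by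
  refine Continuous.stronglyMeasurable ?_
  have : Continuous fun q : E × E => (inner ℝ q.1 q.2 : ℝ) := continuous_fst.inner continuous_snd
  fun_prop

theorem stronglyMeasurable_integral_mul_translate {f : E → ℂ} (hf : StronglyMeasurable f)
    {m K : E × E → ℂ} (hm : StronglyMeasurable m) (hK : StronglyMeasurable K) :
    StronglyMeasurable fun q : E × E => ∫ x, f x * m (x, q.1) * K (q.1, x - q.2) := by
  have h1 : StronglyMeasurable fun q : (E × E) × E => f q.2 := hf.comp_measurable measurable_snd
  have h2 : StronglyMeasurable fun q : (E × E) × E => m (q.2, q.1.1) :=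
    hm.comp_measurable (measurable_snd.prodMk (measurable_fst.comp measurable_fst))
  have h3 : StronglyMeasurable fun q : (E × E) × E => K (q.1.1, q.2 - q.1.2) :=
    hK.comp_measurable ((measurable_fst.comp measurable_fst).prodMk
      (measurable_snd.sub (measurable_snd.comp measurable_fst)))
  exact ((h1.mul h2).mul h3).integral_prod_right' (ν := (volume : Measure E))

section Fixed

variable {p : ℝ≥0∞} [Fact (1 ≤ p)] {P : ∀ j, E →L[ℝ] G j} {t : ι → ℝ}
  {u : 𝓢'(E, ℂ)} {f : Lp ℂ p (volume : Measure E)}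

theorem enorm_localFourier_le (hf : Lp.toTemperedDistribution f = bessel P t u) (χ : TestFn E)
    (y ξ : E) : ‖localFourier (restrict u) χ y ξ‖ₑ ≤
      ∫⁻ x, ‖f x‖ₑ * ‖kernel P (-t) (toSchwartz χ) ξ (x - y)‖ₑ := by
  rw [localFourier_eq_integral P t hf]
  refine (enorm_integral_le_lintegral_enorm _).trans (le_of_eq ?_)
  refine lintegral_congr fun x => ?_
  rw [enorm_mul, enorm_mul, enorm_exp_neg_I_mul, mul_one]

/-- Young's inequality bounds `U` by the `L¹` norm of the kernel. -/
theorem U_le (hf : Lp.toTemperedDistribution f = bessel P t u) (χ : TestFn E) (ξ : E) :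
    U (restrict u) χ p ξ ≤
      eLpNorm f p * eLpNorm (kernel P (-t) (toSchwartz χ) ξ) 1 := by
  have hg : Measurable fun z => ‖kernel P (-t) (toSchwartz χ) ξ z‖ₑ :=
    (kernel P (-t) (toSchwartz χ) ξ).continuous.measurable.enorm
  have hp1 : 1 ≤ p := Fact.out
  rw [U, eLpNorm_one_eq_lintegral_enorm]
  split_ifs with hp
  · subst hp
    exact iSup_le fun y => (enorm_localFourier_le hf χ y ξ).trans
      (lintegral_enorm_mul_sub_le volume f hg y)
  · have hr : 1 ≤ p.toReal := by
      rw [← ENNReal.toReal_one]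
      exact ENNReal.toReal_mono hp hp1
    have hr0 : 0 < p.toReal := one_pos.trans_le hr
    rw [eLpNorm_eq_lintegral_rpow_enorm_toReal (one_pos.trans_le hp1).ne' hp]
    have h1 : ∫⁻ y, ‖localFourier (restrict u) χ y ξ‖ₑ ^ p.toReal ≤
        (∫⁻ x, ‖f x‖ₑ ^ p.toReal) *
          (∫⁻ x, ‖kernel P (-t) (toSchwartz χ) ξ x‖ₑ) ^ p.toReal :=
      (lintegral_mono fun y => ENNReal.rpow_le_rpow (enorm_localFourier_le hf χ y ξ) hr0.le).trans
        (lintegral_rpow_lintegral_mul_sub_le volume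
          (Lp.stronglyMeasurable f).measurable.enorm hg hr)
    refine (ENNReal.rpow_le_rpow h1 (by positivity)).trans (le_of_eq ?_)
    rw [ENNReal.mul_rpow_of_nonneg _ _ (by positivity),
      ← ENNReal.rpow_mul (∫⁻ x, ‖kernel _ _ _ _ x‖ₑ),
      mul_one_div_cancel hr0.ne', ENNReal.rpow_one]

theorem stronglyMeasurable_localFourier (hf : Lp.toTemperedDistribution f = bessel P t u)
    (χ : TestFn E) : StronglyMeasurable fun q : E × E => localFourier (restrict u) χ q.2 q.1 := by
  simp only [localFourier_eq_integral P t hf]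
  exact stronglyMeasurable_integral_mul_translate (Lp.stronglyMeasurable f)
    stronglyMeasurable_modulation (stronglyMeasurable_kernel P (-t) (toSchwartz χ))

theorem continuous_localFourier_top {f : Lp ℂ ∞ (volume : Measure E)}
    (hf : Lp.toTemperedDistribution f = bessel P t u) (χ : TestFn E) (ξ : E) :
    Continuous fun y => localFourier (restrict u) χ y ξ := by
  simp only [localFourier_eq_integral P t hf]
  have hm : StronglyMeasurable fun x : E =>
      f x * Complex.exp (-Complex.I * (inner ℝ x ξ : ℝ)) :=
    (Lp.stronglyMeasurable f).mul (stronglyMeasurable_modulation.comp_measurable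
      (measurable_id.prodMk measurable_const))
  refine continuous_integral_mul_translate volume hm.aestronglyMeasurable (M := ‖f‖) ?_ _
  filter_upwards [enorm_ae_le_eLpNormEssSup f volume] with x hx
  rw [← eLpNorm_exponent_top] at hx
  rw [norm_mul, show ‖Complex.exp (-Complex.I * (inner ℝ x ξ : ℝ))‖ = 1 by
    rw [← toReal_enorm, enorm_exp_neg_I_mul, ENNReal.toReal_one], mul_one, Lp.norm_def,
    ← toReal_enorm]
  exact ENNReal.toReal_mono (Lp.eLpNorm_ne_top f) hx

theorem measurable_U (hf : Lp.toTemperedDistribution f = bessel P t u) (χ : TestFn E) :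
    Measurable (U (restrict u) χ p) := by
  have hm : Measurable fun q : E × E => localFourier (restrict u) χ q.2 q.1 :=
    (stronglyMeasurable_localFourier hf χ).measurable
  have hc : p = ∞ → ∀ ξ, Continuous fun y => localFourier (restrict u) χ y ξ := by
    rintro rfl
    exact continuous_localFourier_top hf χ
  unfold U
  generalize localFourier (restrict u) χ = Φ at hm hc ⊢
  split_ifs with hp
  · exact measurable_iSup_enorm_of_continuous (hc hp)
      fun y => hm.comp (measurable_id.prodMk measurable_const)
  · exact (Measurable.lintegral_prod_right' (hm.enorm.pow_const p.toReal)).pow_const _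

end Fixed

/-- The embedding, for a family of projections that identifies `E` with the product of the
spaces `G j`. -/
theorem embedsInSw_of_equiv [∀ j, FiniteDimensional ℝ (G j)] (P : ∀ j, E →L[ℝ] G j)
    (T : E ≃L[ℝ] (∀ j, G j)) (hT : ∀ ξ j, T ξ j = P j ξ) {t : ι → ℝ}
    (ht : ∀ j, (Module.finrank ℝ (G j) : ℝ) < t j) (p : ℝ≥0∞) [Fact (1 ≤ p)] :
    EmbedsInSw P t p := by
  have ht0 : ∀ j, 0 ≤ t j := fun j => (Nat.cast_nonneg _).trans (ht j).le
  set I : ℝ≥0∞ := ∫⁻ ξ, ENNReal.ofReal (weight P (-t) ξ) with hI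
  have hIfin : I < ∞ := (integrable_weight_neg P T hT ht).lintegral_lt_top
  have hU : ∀ χ : TestFn E, ∃ C : ℝ≥0, ∀ u : besselSpace P t p, ∀ ξ,
      U (restrict (u : 𝓢'(E, ℂ))) χ p ξ ≤
        ENNReal.ofReal (besselNorm u) * (C * ENNReal.ofReal (weight P (-t) ξ)) := by
    intro χ
    obtain ⟨C, hC⟩ := exists_eLpNorm_kernel_le P ht0 (toSchwartz χ)
    refine ⟨C, fun u ξ => ?_⟩
    obtain ⟨f, hf⟩ := mem_besselSpace.1 u.2
    rw [besselNorm_eq u f hf, Lp.norm_def, ENNReal.ofReal_toReal (Lp.eLpNorm_ne_top f)]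
    exact (U_le hf χ ξ).trans (mul_le_mul_right (hC ξ) _)
  have hnorm : ∀ χ : TestFn E, ∃ C : ℝ≥0, ∀ u : besselSpace P t p,
      swNorm p χ (restrict (u : 𝓢'(E, ℂ))) ≤ C * ENNReal.ofReal (besselNorm u) := by
    intro χ
    obtain ⟨C, hC⟩ := hU χ
    refine ⟨C * I.toNNReal, fun u => (lintegral_mono (hC u)).trans (le_of_eq ?_)⟩
    have hw : Measurable fun ξ => ENNReal.ofReal (weight P (-t) ξ) :=
      (continuous_weight P (-t)).measurable.ennreal_ofReal
    rw [lintegral_const_mul _ (hw.const_mul _), lintegral_const_mul _ hw, ENNReal.coe_mul,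
      ENNReal.coe_toNNReal hIfin.ne, mul_comm]
  refine ⟨fun u => ?_, fun u v huv => Subtype.ext (restrict_injective huv), fun χ _ => hnorm χ⟩
  obtain ⟨χ, hχ⟩ := exists_testFn_ne_zero (E := E)
  obtain ⟨f, hf⟩ := mem_besselSpace.1 u.2
  refine ⟨χ, hχ, fun ξ => ?_, (measurable_U hf χ).aemeasurable, ?_⟩
  · obtain ⟨C, hC⟩ := hU χ
    exact (hC u ξ).trans_lt (ENNReal.mul_lt_top ENNReal.ofReal_lt_top
      (ENNReal.mul_lt_top ENNReal.coe_lt_top ENNReal.ofReal_lt_top))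
  · obtain ⟨C, hC⟩ := hnorm χ
    exact (hC u).trans_lt (ENNReal.mul_lt_top ENNReal.coe_lt_top ENNReal.ofReal_lt_top)

end Embedding

end Sjostrand

theorem mainTheorem4 (p : ℝ≥0∞) [Fact (1 ≤ p)] (k : ℕ) (t : Fin k → ℝ) :
    (∀ m : Fin k → ℕ, (∀ j, (m j : ℝ) < t j) →
      Sjostrand.EmbedsInSw
        (fun j => PiLp.proj (𝕜 := ℝ) 2 (fun j : Fin k => EuclideanSpace ℝ (Fin (m j))) j) t p) ∧
    (∀ (n : ℕ) (V : Fin k → Submodule ℝ (EuclideanSpace ℝ (Fin n))),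
      DirectSum.IsInternal V →
      OrthogonalFamily ℝ (fun j => V j) (fun j => (V j).subtypeₗᵢ) →
      (∀ j, (Module.finrank ℝ (V j) : ℝ) < t j) →
      Sjostrand.EmbedsInSw (fun j => (V j).orthogonalProjectionOnto) t p) := by
  refine ⟨fun m hm => ?_, fun n V hV hO ht => ?_⟩
  · exact Sjostrand.embedsInSw_of_equiv _
      (PiLp.continuousLinearEquiv 2 ℝ fun j : Fin k => EuclideanSpace ℝ (Fin (m j)))
      (fun _ _ => rfl) (fun j => by simpa using hm j) p
  · obtain ⟨T, hT⟩ := Sjostrand.exists_equiv_orthogonalProjection V hV hO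
    exact Sjostrand.embedsInSw_of_equiv _ T hT ht p
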